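/- A signed hypergraph $H=(V,S)$ consists of a finite set $V$ of nodes and a finite set $S$ of signed edges $s=(e,\eta_s)$, where $e\subseteq V$, $|e|\ge 2$ and $\eta_s:e\to\{-1,+1\}$ (no two elements of $S$ are identical, but several may have the same underlying edge $e$). Set-theoretic notation for $s$ refers to its underlying edge $e$; in particular $v\in s$ means $v\in e$, $|s|=|e|$, and $s\subseteq s'$ means inclusion of the underlying edges. The rank $r$ of $H$ is $\max_{s\in S}|s|$. The pseudo-Boolean polytope $\mathrm{PBP}(H)$ is the convex hull of the set of all $z\in\{0,1\}^{V\cup S}$ with $z_s=\prod_{v\in s}\sigma_s(z_v)$ for all $s\in S$, where $\sigma_s(z_v)=z_v$ if $\eta_s(v)=+1$ and $\sigma_s(z_v)=1-z_v$ if $\eta_s(v)=-1$. An extended formulation of a polytope $P$ is a system of linear inequalities in variables $(z,y)$ such that the projection of its solution set onto the $z$-space is $P$; all variables $(z,y)$ are counted, and an equation counts as two inequalities. A signed edge $s\in S$ is maximal if no $s'\in S$ satisfies $s'\supsetneq s$; let $\bar S$ be the set of maximal signed edges. For a set $S'$ of signed edges with set $E'$ of underlying edges, $\mathrm{gap}(S')=\max_{e\in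 E'}\left(\left|\bigcup_{f\in E'}f\right|-|e|\right)$. In a hypergraph $G$, a node $v$ is a $\beta$-leaf if the edges containing $v$ are totally ordered by inclusion; $G-v$ is obtained by deleting $v$ from the node set and from all edges and dropping empty edges; $G$ is $\beta$-acyclic if its nodes can be ordered $v_1,\dots,v_n$ such that $v_i$ is a $\beta$-leaf of $G-v_1-\cdots-v_{i-1}$ for every $i$. **Proposition.** Let $H=(V,S)$ be a signed hypergraph of rank $r$ with $S\neq\emptyset$. For each $s\in S$ let $f_s$ be a maximal signed edge of minimum cardinality among the maximal signed edges containing $s$, and let $k$ be a nonnegative integer with $\mathrm{gap}(\{s,f_s\})\le k$ for all $s\in S$. Suppose that the hypergraph with node set $V$ whose edges are the underlying edges of the elements of $\bar S$ is $\beta$-acyclic. Then $\mathrm{PBP}(H)$ has an extended formulation with $O(r\,2^k\,|V|\,|S|)$ variables and inequalities (the constant being absolute) in which all coefficients and right-hand side constants are $0,\pm1$. In particular, if $k=O(\log \mathrm{poly}(|V|,|S|))$, then $\mathrm{PBP}(H)$ has an extended formulation of size polynomial in $|V|,|S|$ with all coefficients and right-hand side constants $0,\pm1$; that is, for every real $c$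 and every two-variable polynomial $p$ with coefficients in $\mathbb{N}$ there is a two-variable polynomial $q$ with coefficients in $\mathbb{N}$ such that, for all $H$ and $k$ as above with $k\le c\log p(|V|,|S|)$ (with the convention $\log 0=0$), there is such a formulation with at most $q(|V|,|S|)$ variables and at most $q(|V|,|S|)$ inequalities. -/

import Mathlib

universe u

namespace PseudoBoolean

/-- The gap of a finite set of edges: the maximum of `|⋃ E'| - |e|` over `e ∈ E'`. (Each `e ∈ E'`
is contained in the union, so the subtraction of natural numbers is exact.) -/
def edgeGap {V : Type*} [DecidableEq V] (E' : Finset (Finset V)) : ℕ :=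
  E'.sup fun e => (E'.biUnion id).card - e.card

/-- The hypergraph `G - v`: its nodes are the nodes of `G` other than `v`, and its edges are the
sets `e \ {v}`, `e` an edge of `G`, that are nonempty. -/
def removeNode {V : Type*} (G : Hypergraph V) (v : V) : Hypergraph V where
  vertexSet := G.vertexSet \ {v}
  edgeSet := {f | f.Nonempty ∧ ∃ e ∈ G.edgeSet, f = e \ {v}}
  subset_vertexSet_of_mem_edgeSet' := by
    rintro f ⟨-, e, he, rfl⟩
    exact Set.sdiff_subset_sdiff_left (G.subset_vertexSet_of_mem_edgeSet' he)

/-- A node `v` is a β-leaf if the edges containing `v` are totally ordered by inclusion. -/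
def IsBetaLeaf {V : Type*} (G : Hypergraph V) (v : V) : Prop :=
  v ∈ G.vertexSet ∧ IsChain (· ⊆ ·) {e : Set V | e ∈ G.edgeSet ∧ v ∈ e}

/-- `v₁, …, vₜ` is a sequence of β-leaves: `v₁` is a β-leaf of `G`, `v₂` is a β-leaf of `G - v₁`,
and so on. (The nodes are automatically distinct, since removed nodes are no longer nodes.) -/
def IsBetaLeafSeq {V : Type*} : Hypergraph V → List V → Prop
  | _, [] => True
  | G, v :: l => IsBetaLeaf G v ∧ IsBetaLeafSeq (removeNode G v) l

/-- A hypergraph with finitely many nodes is β-acyclic if it has a sequence of β-leaves whose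
length is the number of nodes. -/
def BetaAcyclic {V : Type*} (G : Hypergraph V) : Prop :=
  ∃ l : List V, IsBetaLeafSeq G l ∧ l.length = G.vertexSet.ncard

/-- A signed edge on `V`: a subset `edge` of `V` of cardinality at least two, with a sign `+1` or
`-1` for each of its elements (`ℤˣ = {1, -1}`). -/
@[ext]
structure SignedEdge (V : Type*) where
  edge : Finset V
  sign : {v // v ∈ edge} → ℤˣ
  two_le_card : 2 ≤ edge.card

noncomputable instance (V : Type*) : DecidableEq (SignedEdge V) := Classical.decEq _

/-- A signed hypergraph whose node set is the (finite) type `V`: a finite set of signed edges, so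
that no two of them are identical, while several of them may have the same underlying edge. -/
@[ext]
structure SignedHypergraph (V : Type*) where
  signedEdges : Finset (SignedEdge V)

/-- `σ(t) = t` for the sign `+1` and `σ(t) = 1 - t` for the sign `-1`. -/
def signedValue (ε : ℤˣ) (t : ℝ) : ℝ := if ε = 1 then t else 1 - t

namespace SignedHypergraph

variable {V : Type*}

/-- The underlying hypergraph: signs are ignored and parallel edges are merged. -/
def underlying (H : SignedHypergraph V) : Hypergraph V where
  vertexSet := Set.univ
  edgeSet := {e | ∃ s ∈ H.signedEdges, e = (s.edge : Set V)}
  subset_vertexSet_of_mem_edgeSet' := fun _ _ => Set.subset_univ _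

/-- The rank of a signed hypergraph: the maximum cardinality of its edges. -/
def rank (H : SignedHypergraph V) : ℕ := H.signedEdges.sup fun s => s.edge.card

/-- The gap of a set of signed edges: the gap of the set of their underlying edges. -/
def gap [DecidableEq V] (S' : Finset (SignedEdge V)) : ℕ := edgeGap (S'.image SignedEdge.edge)

/-- A signed edge of `H` is maximal if its underlying edge is not properly contained in the
underlying edge of another signed edge of `H`. -/
def IsMaximal (H : SignedHypergraph V) (s : SignedEdge V) : Prop :=
  s ∈ H.signedEdges ∧ ∀ s' ∈ H.signedEdges, ¬ s.edge ⊂ s'.edge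

open Classical in
/-- The signed hypergraph formed by all nodes and the maximal signed edges of `H`. -/
noncomputable def maximalPart (H : SignedHypergraph V) : SignedHypergraph V where
  signedEdges := H.signedEdges.filter fun s => H.IsMaximal s

/-- `f` is, among the maximal signed edges of `H` that contain `s`, one of minimum cardinality. -/
def IsMinMaximalContaining (H : SignedHypergraph V) (s f : SignedEdge V) : Prop :=
  (H.IsMaximal f ∧ s.edge ⊆ f.edge) ∧
    ∀ g : SignedEdge V, H.IsMaximal g → s.edge ⊆ g.edge → f.edge.card ≤ g.edge.card

/-- The index set `V ∪ S` of the coordinates. -/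
abbrev Coord (H : SignedHypergraph V) : Type _ := V ⊕ {s // s ∈ H.signedEdges}

/-- The pseudo-Boolean set: the `0/1` points `z` with `z_s = ∏_{v ∈ s} σ_s(z_v)` for all `s`. -/
def pseudoBooleanSet (H : SignedHypergraph V) : Set (H.Coord → ℝ) :=
  {z | (∀ c, z c = 0 ∨ z c = 1) ∧
    ∀ s : {s // s ∈ H.signedEdges},
      z (Sum.inr s) =
        ∏ v : {v // v ∈ s.1.edge}, signedValue (s.1.sign v) (z (Sum.inl v.1))}

/-- The pseudo-Boolean polytope: the convex hull of the pseudo-Boolean set. -/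
def pseudoBooleanPolytope (H : SignedHypergraph V) : Set (H.Coord → ℝ) :=
  convexHull ℝ H.pseudoBooleanSet

end SignedHypergraph

/-- The system `A z + B y ≤ b`, with `p` additional variables `y` and `m` inequalities, is an
extended formulation of `P`: the projection onto the `z`-space of its solution set is `P`. -/
def IsExtendedFormulation {ι : Type*} [Fintype ι] (P : Set (ι → ℝ)) {m p : ℕ}
    (A : Matrix (Fin m) ι ℝ) (B : Matrix (Fin m) (Fin p) ℝ) (b : Fin m → ℝ) : Prop :=
  P = {z | ∃ y : Fin p → ℝ, ∀ i, ∑ j, A i j * z j + ∑ l, B i l * y l ≤ b i}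

/-- `P` has an extended formulation with at most `N` variables (original and additional ones
together) and at most `N` inequalities (an equation counts as two inequalities) in which all
coefficients and right-hand sides are `0`, `1` or `-1`. -/
def HasUnitExtendedFormulation {ι : Type*} [Fintype ι] (P : Set (ι → ℝ)) (N : ℕ) : Prop :=
  ∃ (m p : ℕ) (A : Matrix (Fin m) ι ℝ) (B : Matrix (Fin m) (Fin p) ℝ) (b : Fin m → ℝ),
    IsExtendedFormulation P A B b ∧
    (∀ i j, A i j ∈ ({0, 1, -1} : Set ℝ)) ∧
    (∀ i l, B i l ∈ ({0, 1, -1} : Set ℝ)) ∧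
    (∀ i, b i ∈ ({0, 1, -1} : Set ℝ)) ∧
    Fintype.card ι + p ≤ N ∧ m ≤ N

end PseudoBoolean

/-! Inflate each signed edge `s`: its product is the sum of the indicators of the at most `2 ^ k`
extensions of its partial assignment to the underlying edge of `f s`. This leaves a family `P` of at
most `|S| * 2 ^ k` partial assignments whose domains are edges of a β-acyclic hypergraph. It remains
to describe which masses `y t` are the probabilities, under one distribution on `V → Bool`, that `t`
is satisfied.

The nodes are removed in the β-leaf order. For a β-leaf `v`, the links (members of `P` assigning
`v`, with that value dropped, and `empty`) have nested domains. Hence each total assignment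
satisfies a greatest link, and the satisfied links are exactly those below it. Variables `w` give
the joint law of this greatest link and the value of `v`; the masses of links extended to `v` are
their upper sums.

For soundness (`NodeSystem.exists_expectation`), take a distribution that fits the masses after `v`
is removed. Möbius inversion shows that its law of the greatest link is the marginal of `w`.
Resampling the value of `v` conditionally on the greatest link then realizes the masses involving
`v` and leaves the others unchanged. Distributions appear as positive linear functionals `E` with `E
1 = 1`, and the shared masses `y` tie the stages together. Conversely, every `0/1` point satisfies
the system (`listSystem_linkValue`), and convexity does the rest. Each node costs `O(|P| + 1)`
variables and inequalities. -/

namespace PseudoBoolean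

/-! ### Partial assignments, their indicators, and links. -/

/-- A partial `0/1` assignment of the nodes. -/
def PartialAssignment (V : Type*) : Type _ := V → Option Bool

namespace PartialAssignment

variable {V : Type*}

noncomputable instance : DecidableEq (PartialAssignment V) := Classical.decEq _

instance [Finite V] : Finite (PartialAssignment V) := inferInstanceAs (Finite (V → Option Bool))

noncomputable instance [Finite V] : Fintype (PartialAssignment V) := Fintype.ofFinite _

/-- `t ≤ t'` if `t'` extends `t`. -/
instance : PartialOrder (PartialAssignment V) where
  le t t' := ∀ v a, t v = some a → t' v = some a
  le_refl _ _ _ h := h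
  le_trans _ _ _ h h' v a ha := h' v a (h v a ha)
  le_antisymm t t' h h' := by
    funext v
    cases ht : t v with
    | some a => exact (h v a ht).symm
    | none =>
      cases ht' : t' v with
      | none => rfl
      | some a => rw [h' v a ht'] at ht; cases ht

noncomputable instance : DecidableLE (PartialAssignment V) := fun _ _ => Classical.propDecidable _

/-- The assignment that assigns nothing. -/
def empty : PartialAssignment V := fun _ => none

/-- The set of nodes that have a value. -/
def dom (t : PartialAssignment V) : Set V := {v | t v ≠ none}

theorem mem_dom {t : PartialAssignment V} {v : V} : v ∈ t.dom ↔ t v ≠ none := Iff.rfl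

/-- The total assignment `x` extends `t`. -/
def Holds (t : PartialAssignment V) (x : V → Bool) : Prop := ∀ v a, t v = some a → x v = a

theorem Holds.mono {t t' : PartialAssignment V} {x : V → Bool} (h : t ≤ t') (hx : t'.Holds x) :
    t.Holds x := fun v a hv => hx v a (h v a hv)

theorem Holds.le_of_dom_subset {t t' : PartialAssignment V} {x : V → Bool} (ht : t.Holds x)
    (ht' : t'.Holds x) (h : t.dom ⊆ t'.dom) : t ≤ t' := by
  intro v a hv
  have hd : t' v ≠ none := h (by rw [mem_dom, hv]; simp)
  obtain ⟨b, hb⟩ := Option.ne_none_iff_exists'.1 hd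
  rw [hb, ← ht v a hv, ← ht' v b hb]

open Classical in
/-- The indicator function of the set of total assignments that extend `t`. -/
noncomputable def ind (t : PartialAssignment V) (x : V → Bool) : ℝ := if t.Holds x then 1 else 0

theorem holds_empty (x : V → Bool) : (empty : PartialAssignment V).Holds x := by
  intro v a h; cases h

theorem ind_empty : ind (empty : PartialAssignment V) = 1 := by
  funext x; simp [ind, holds_empty]

/-- If the domains of the members of `D` are nested, then `D ∋ empty` has, for each total
assignment `x`, a greatest member that `x` extends. -/
theorem exists_greatest_holds {D : Finset (PartialAssignment V)} (h0 : empty ∈ D)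
    (hD : ∀ d ∈ D, ∀ d' ∈ D, d.dom ⊆ d'.dom ∨ d'.dom ⊆ d.dom) (x : V → Bool) :
    ∃ m ∈ D, ∀ d ∈ D, d.Holds x ↔ d ≤ m := by
  classical
  obtain ⟨m, hm⟩ := (D.filter fun d => d.Holds x).exists_maximal
    ⟨empty, Finset.mem_filter.2 ⟨h0, holds_empty x⟩⟩
  obtain ⟨hmD, hmx⟩ := Finset.mem_filter.1 hm.prop
  refine ⟨m, hmD, fun d hd => ⟨fun hx => ?_, fun h => hmx.mono h⟩⟩
  -- Both `d` and `m` are restrictions of `x`, so nested domains make them comparable; maximality of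
  -- `m` settles the second case.
  rcases hD d hd m hmD with h | h
  · exact hx.le_of_dom_subset hmx h
  · exact hm.le_of_ge (Finset.mem_filter.2 ⟨hd, hx⟩) (hmx.le_of_dom_subset hx h)

variable [DecidableEq V]

/-- The assignment with the value at `v` dropped. -/
def erase (v : V) (t : PartialAssignment V) : PartialAssignment V :=
  fun u => if u = v then none else t u

/-- The assignment with the value at `v` set to `a`. -/
def set (v : V) (a : Bool) (t : PartialAssignment V) : PartialAssignment V :=
  fun u => if u = v then some a else t u

theorem erase_self (v : V) (t : PartialAssignment V) : t.erase v v = none := if_pos rfl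

theorem erase_of_ne {u v : V} (h : u ≠ v) (t : PartialAssignment V) : t.erase v u = t u := if_neg h

theorem set_self (v : V) (a : Bool) (t : PartialAssignment V) : t.set v a v = some a := if_pos rfl

theorem set_of_ne {u v : V} (h : u ≠ v) (a : Bool) (t : PartialAssignment V) :
    t.set v a u = t u := if_neg h

theorem erase_eq_self {v : V} {t : PartialAssignment V} (h : t v = none) : t.erase v = t := by
  funext u
  by_cases hu : u = v
  · rw [hu, erase_self, h]
  · exact erase_of_ne hu t

theorem set_erase {v : V} {a : Bool} {t : PartialAssignment V} (h : t v = some a) :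
    (t.erase v).set v a = t := by
  funext u
  by_cases hu : u = v
  · rw [hu, set_self, h]
  · rw [set_of_ne hu, erase_of_ne hu]

theorem set_true_ne_set_false (v : V) (t : PartialAssignment V) : t.set v true ≠ t.set v false := by
  intro h
  have := congrFun h v
  rw [set_self, set_self] at this
  cases this

theorem dom_erase (v : V) (t : PartialAssignment V) : (t.erase v).dom = t.dom \ {v} := by
  ext u
  by_cases hu : u = v
  · simp [mem_dom, hu, erase_self]
  · simp [mem_dom, hu, erase_of_ne]

theorem holds_set {v : V} {a : Bool} {t : PartialAssignment V} (h : t v = none) {x : V → Bool} :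
    (t.set v a).Holds x ↔ t.Holds x ∧ x v = a := by
  constructor
  · intro hx
    refine ⟨fun u b hu => hx u b ?_, hx v a (set_self v a t)⟩
    rw [set_of_ne, hu]
    rintro rfl
    rw [h] at hu; cases hu
  · rintro ⟨hx, hv⟩ u b hu
    by_cases huv : u = v
    · subst huv
      rw [set_self] at hu
      rw [hv]; exact Option.some.inj hu
    · rw [set_of_ne huv] at hu
      exact hx u b hu

theorem holds_update {v : V} {a : Bool} {t : PartialAssignment V} (h : t v = none) {x : V → Bool} :
    t.Holds (Function.update x v a) ↔ t.Holds x := by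
  refine forall_congr' fun u => forall_congr' fun b => imp_congr_right fun hu => ?_
  rw [Function.update_of_ne]
  rintro rfl
  rw [h] at hu; cases hu

theorem ind_update {v : V} {a : Bool} {t : PartialAssignment V} (h : t v = none) (x : V → Bool) :
    t.ind (Function.update x v a) = t.ind x := by
  have := holds_update (a := a) h (x := x)
  by_cases hx : t.Holds x <;> simp [ind, this, hx]

theorem ind_set {v : V} {a : Bool} {t : PartialAssignment V} (h : t v = none) (x : V → Bool) :
    (t.set v a).ind x = t.ind x * if x v = a then 1 else 0 := by
  have := holds_set (a := a) h (x := x)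
  by_cases h1 : t.Holds x <;> by_cases h2 : x v = a <;> simp [ind, this, h1, h2]

/-- The restrictions to the other nodes of the members of `P` that assign `v`, and `empty`. -/
noncomputable def links (P : Finset (PartialAssignment V)) (v : V) :
    Finset (PartialAssignment V) :=
  insert empty ((P.filter fun t => t v ≠ none).image (erase v))

theorem empty_mem_links (P : Finset (PartialAssignment V)) (v : V) : empty ∈ links P v :=
  Finset.mem_insert_self _ _

theorem erase_mem_links {P : Finset (PartialAssignment V)} {v : V} {t : PartialAssignment V}
    (ht : t ∈ P) (hv : t v ≠ none) : t.erase v ∈ links P v :=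
  Finset.mem_insert_of_mem (Finset.mem_image_of_mem _ (Finset.mem_filter.2 ⟨ht, hv⟩))

theorem mem_links {P : Finset (PartialAssignment V)} {v : V} {d : PartialAssignment V}
    (hd : d ∈ links P v) : d = empty ∨ ∃ t ∈ P, t v ≠ none ∧ t.erase v = d := by
  rcases Finset.mem_insert.1 hd with h | h
  · exact Or.inl h
  · obtain ⟨t, ht, rfl⟩ := Finset.mem_image.1 h
    exact Or.inr ⟨t, (Finset.mem_filter.1 ht).1, (Finset.mem_filter.1 ht).2, rfl⟩

theorem apply_eq_none_of_mem_links {P : Finset (PartialAssignment V)} {v : V}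
    {d : PartialAssignment V} (hd : d ∈ links P v) : d v = none := by
  rcases mem_links hd with rfl | ⟨t, -, -, rfl⟩
  · rfl
  · exact erase_self v t

theorem card_links_le (P : Finset (PartialAssignment V)) (v : V) :
    (links P v).card ≤ P.card + 1 :=
  (Finset.card_insert_le _ _).trans
    (Nat.succ_le_succ (Finset.card_image_le.trans (Finset.card_filter_le _ _)))

/-- The edges through a β-leaf form a chain, and deleting `v` preserves inclusions; `empty` has the
least domain. -/
theorem links_nested {G : Hypergraph V} {P : Finset (PartialAssignment V)} {v : V}
    (hv : IsBetaLeaf G v) (hG : ∀ t ∈ P, t.dom.Nonempty → t.dom ∈ G.edgeSet) :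
    ∀ d ∈ links P v, ∀ d' ∈ links P v, d.dom ⊆ d'.dom ∨ d'.dom ⊆ d.dom := by
  have hempty : (empty : PartialAssignment V).dom = ∅ := by ext u; simp [mem_dom, empty]
  intro d hd d' hd'
  rcases mem_links hd with rfl | ⟨t, ht, htv, rfl⟩
  · left; simp [hempty]
  rcases mem_links hd' with rfl | ⟨t', ht', htv', rfl⟩
  · right; simp [hempty]
  rw [dom_erase, dom_erase]
  exact (hv.2.total ⟨hG t ht ⟨v, htv⟩, htv⟩ ⟨hG t' ht' ⟨v, htv'⟩, htv'⟩).imp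
    Set.sdiff_subset_sdiff_left Set.sdiff_subset_sdiff_left

end PartialAssignment

/-! ### Soundness: a solution of the constraints comes from a distribution. -/

/-- A function on a finite partial order is determined by its sums over the upper intervals. -/
theorem eqOn_of_sum_filter_le_eq {α : Type*} [PartialOrder α] [Finite α] [DecidableLE α]
    {D : Finset α} {f g : α → ℝ}
    (h : ∀ d ∈ D, ∑ d' ∈ D with d ≤ d', f d' = ∑ d' ∈ D with d ≤ d', g d') :
    ∀ d ∈ D, f d = g d := by
  classical
  intro d
  induction d using WellFoundedGT.induction with
  | _ d ih =>
    intro hd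
    have hmem : d ∈ D.filter (d ≤ ·) := Finset.mem_filter.2 ⟨hd, le_rfl⟩
    have := h d hd
    rw [← Finset.add_sum_erase _ _ hmem, ← Finset.add_sum_erase _ _ hmem] at this
    have hs : ∑ d' ∈ (D.filter (d ≤ ·)).erase d, f d' = ∑ d' ∈ (D.filter (d ≤ ·)).erase d, g d' := by
      refine Finset.sum_congr rfl fun d' hd' => ?_
      obtain ⟨hne, hd'⟩ := Finset.mem_erase.1 hd'
      obtain ⟨hD, hle⟩ := Finset.mem_filter.1 hd'
      exact ih d' (lt_of_le_of_ne hle hne.symm) hD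
    linarith

open PartialAssignment

variable {V : Type*} [DecidableEq V]

/-- The indices of the variables that describe the joint distribution of the value of a node and of
the greatest member of a set of partial assignments that is satisfied. -/
abbrev LinkIndex (V : Type*) : Type _ :=
  V × Finset (PartialAssignment V) × PartialAssignment V × Bool

/-- The constraints for the node `v`, whose links are `D`. -/
structure NodeSystem (v : V) (D : Finset (PartialAssignment V)) (y : PartialAssignment V → ℝ)
    (w : LinkIndex V → ℝ) : Prop where
  nonneg : ∀ d ∈ D, ∀ a, 0 ≤ w (v, D, d, a)
  split : ∀ d ∈ D, y d = y (d.set v true) + y (d.set v false)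
  sum_eq : ∀ d ∈ D, ∀ a, y (d.set v a) = ∑ d' ∈ D with d ≤ d', w (v, D, d', a)

/-- The constraints for all nodes of a list, which are removed one after another. -/
def ListSystem (y : PartialAssignment V → ℝ) (w : LinkIndex V → ℝ) :
    List V → Finset (PartialAssignment V) → Prop
  | [], _ => True
  | v :: l, P => NodeSystem v (links P v) y w ∧ ListSystem y w l (P.image (erase v))

/-- If the masses of the links of `v` are those of a distribution, then this distribution can be
changed at `v` so that the masses of the extensions of the links to `v` are as prescribed. -/
theorem NodeSystem.exists_expectation {v : V} {D : Finset (PartialAssignment V)}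
    {y : PartialAssignment V → ℝ} {w : LinkIndex V → ℝ} (h : NodeSystem v D y w) [Finite V]
    (h0 : empty ∈ D) (hv : ∀ d ∈ D, d v = none)
    (hD : ∀ d ∈ D, ∀ d' ∈ D, d.dom ⊆ d'.dom ∨ d'.dom ⊆ d.dom)
    (E : ((V → Bool) → ℝ) →ₗ[ℝ] ℝ) (hE : ∀ g, 0 ≤ g → 0 ≤ E g) (hy : ∀ d ∈ D, y d = E d.ind) :
    ∃ E' : ((V → Bool) → ℝ) →ₗ[ℝ] ℝ, (∀ g, 0 ≤ g → 0 ≤ E' g) ∧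
      (∀ t : PartialAssignment V, t v = none → E' t.ind = E t.ind) ∧
      ∀ d ∈ D, ∀ a, y (d.set v a) = E' (d.set v a).ind := by
  classical
  choose m hmD hm using exists_greatest_holds h0 hD
  have hind : ∀ d ∈ D, ∀ x, d.ind x = ∑ d' ∈ D with d ≤ d', if m x = d' then (1 : ℝ) else 0 := by
    intro d hd x
    rw [Finset.sum_ite_eq]
    simp only [ind, hm x d hd, Finset.mem_filter, hmD x, true_and]
  -- Both sides have upper sum `y d` at every `d`: the left by `sum_eq` and `split`, the right
  -- because `d` holds at `x` exactly when `d ≤ m x`.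
  have hsum : ∀ d ∈ D, w (v, D, d, true) + w (v, D, d, false) =
      E fun x => if m x = d then 1 else 0 := by
    refine eqOn_of_sum_filter_le_eq fun d hd => ?_
    rw [Finset.sum_add_distrib, ← h.sum_eq d hd, ← h.sum_eq d hd, ← h.split d hd, hy d hd,
      ← map_sum]
    congr 1
    funext x
    rw [hind d hd x, Finset.sum_apply]
  -- The conditional probability that `v` has value `a` when `d` is the greatest satisfied link. On
  -- a null event the value `true` is chosen, so that `κ d` is always a distribution.
  let κ : PartialAssignment V → Bool → ℝ := fun d a =>
    if w (v, D, d, true) + w (v, D, d, false) = 0 then (if a = true then 1 else 0)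
    else w (v, D, d, a) / (w (v, D, d, true) + w (v, D, d, false))
  have hκ0 : ∀ d ∈ D, ∀ a, 0 ≤ κ d a := by
    intro d hd a
    have h1 := h.nonneg d hd
    simp only [κ]
    split_ifs
    · exact zero_le_one
    · exact le_rfl
    · exact div_nonneg (h1 a) (add_nonneg (h1 true) (h1 false))
  have hκ1 : ∀ d, κ d true + κ d false = 1 := by
    intro d
    by_cases h1 : w (v, D, d, true) + w (v, D, d, false) = 0
    · simp [κ, h1]
    · simp only [κ, if_neg h1]
      rw [← add_div, div_self h1]
  have hκw : ∀ d ∈ D, ∀ a, κ d a * (w (v, D, d, true) + w (v, D, d, false)) = w (v, D, d, a) := by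
    intro d hd a
    simp only [κ]
    -- If the total is zero, nonnegativity forces both `w` values to vanish, so the default does no
    -- harm.
    split_ifs with h1 h2
    · have ht := h.nonneg d hd true
      have hf := h.nonneg d hd false
      rw [h2, h1]; linarith
    · have ht := h.nonneg d hd true
      have hf := h.nonneg d hd false
      rw [Bool.eq_false_of_not_eq_true h2, h1]; linarith
    · exact div_mul_cancel₀ _ h1
  -- Averaging over a resampled value of `v`, drawn from `κ (m x)`; the new distribution is `E ∘ₗ
  -- T`.
  let T : ((V → Bool) → ℝ) →ₗ[ℝ] ((V → Bool) → ℝ) :=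
    { toFun := fun g x => κ (m x) true * g (Function.update x v true) +
        κ (m x) false * g (Function.update x v false)
      map_add' := fun g g' => by funext x; simp only [Pi.add_apply]; ring
      map_smul' := fun c g => by
        funext x; simp only [Pi.smul_apply, smul_eq_mul, RingHom.id_apply]; ring }
  have hT : ∀ g x, T g x = κ (m x) true * g (Function.update x v true) +
        κ (m x) false * g (Function.update x v false) := fun _ _ => rfl
  refine ⟨E ∘ₗ T, fun g hg => hE _ fun x => ?_, fun t ht => ?_, fun d hd a => ?_⟩
  · rw [hT]
    exact add_nonneg (mul_nonneg (hκ0 _ (hmD x) _) (hg _)) (mul_nonneg (hκ0 _ (hmD x) _) (hg _))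
  · rw [LinearMap.comp_apply]
    congr 1
    funext x
    rw [hT, ind_update ht, ind_update ht, ← add_mul, hκ1, one_mul]
  · have hTd : T (d.set v a).ind =
        ∑ d' ∈ D with d ≤ d', κ d' a • fun x => if m x = d' then (1 : ℝ) else 0 := by
      funext x
      have h1 : T (d.set v a).ind x = d.ind x * κ (m x) a := by
        rw [hT, ind_set (hv d hd), ind_set (hv d hd), ind_update (hv d hd), ind_update (hv d hd),
          Function.update_self, Function.update_self]
        cases a <;> simp [mul_comm]
      rw [h1, hind d hd, Finset.sum_apply, Finset.sum_mul]
      refine Finset.sum_congr rfl fun d' _ => ?_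
      rw [Pi.smul_apply, smul_eq_mul, mul_comm]
      split_ifs with h2
      · rw [h2]
      · simp
    rw [LinearMap.comp_apply, hTd, map_sum, h.sum_eq d hd]
    refine Finset.sum_congr rfl fun d' hd' => ?_
    have hd'D := (Finset.mem_filter.1 hd').1
    rw [map_smul, ← hsum d' hd'D, smul_eq_mul, hκw d' hd'D]

/-- A solution of the constraints for a sequence of β-leaves gives the masses of a distribution. -/
theorem ListSystem.exists_expectation [Finite V] {y : PartialAssignment V → ℝ}
    {w : LinkIndex V → ℝ} (hy : y empty = 1) (l : List V) :
    ∀ (P : Finset (PartialAssignment V)) (G : Hypergraph V), ListSystem y w l P →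
      IsBetaLeafSeq G l → (∀ t ∈ P, t.dom.Nonempty → t.dom ∈ G.edgeSet) →
      (∀ t ∈ P, ∀ v ∈ t.dom, v ∈ l) →
      ∃ E : ((V → Bool) → ℝ) →ₗ[ℝ] ℝ, (∀ g, 0 ≤ g → 0 ≤ E g) ∧ E 1 = 1 ∧
        (∀ t ∈ P, y t = E t.ind) ∧
        ∀ v ∈ l, y (empty.set v true) = E (empty.set v true).ind := by
  induction l with
  | nil =>
    intro P G _ _ _ hl
    -- With no nodes left only `empty` can occur in `P`, so any point mass works.
    refine ⟨LinearMap.proj fun _ => false, fun g hg => hg _, rfl, fun t ht => ?_, by simp⟩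
    have : t = empty := by
      funext u
      by_contra hu
      exact List.not_mem_nil (hl t ht u hu)
    rw [this, hy, ind_empty]; rfl
  | cons v l ih =>
    intro P G hs hseq hG hl
    obtain ⟨E, hE, hE1, hEP, hEl⟩ := ih (P.image (erase v)) (removeNode G v) hs.2 hseq.2
      (by
        intro t ht hne
        obtain ⟨t, htP, rfl⟩ := Finset.mem_image.1 ht
        rw [dom_erase] at hne ⊢
        exact ⟨hne, t.dom, hG t htP (hne.mono Set.sdiff_subset), rfl⟩)
      (by
        intro t ht u hu
        obtain ⟨t, htP, rfl⟩ := Finset.mem_image.1 ht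
        rw [dom_erase] at hu
        exact (List.mem_cons.1 (hl t htP u hu.1)).resolve_left hu.2)
    obtain ⟨E', hE', hnone, hset⟩ := hs.1.exists_expectation (empty_mem_links P v)
      (fun d => apply_eq_none_of_mem_links) (links_nested hseq.1 hG) E hE (by
        intro d hd
        rcases mem_links hd with rfl | ⟨t, ht, -, rfl⟩
        · rw [hy, ind_empty, hE1]
        · exact hEP _ (Finset.mem_image_of_mem _ ht))
    refine ⟨E', hE', ?_, fun t ht => ?_, fun u hu => ?_⟩
    · rw [← ind_empty, hnone _ rfl, ind_empty, hE1]
    -- Assignments without `v` keep the mass given by induction; the others are links extended to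
    -- `v`.
    · cases htv : t v with
      | none =>
        rw [hnone t htv]
        exact hEP t (Finset.mem_image.2 ⟨t, ht, erase_eq_self htv⟩)
      | some a =>
        have := hset _ (erase_mem_links ht (by rw [htv]; simp)) a
        rwa [set_erase htv] at this
    · by_cases huv : u = v
      · rw [huv]; exact hset _ (empty_mem_links P v) true
      · rw [hnone _ (set_of_ne (Ne.symm huv) _ _)]
        exact hEl u ((List.mem_cons.1 hu).resolve_left huv)

/-! ### Completeness: `0/1` points satisfy the constraints. -/

open Classical in
/-- The values of the link variables at a total assignment. -/
noncomputable def linkValue (x : V → Bool) : LinkIndex V → ℝ := fun i =>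
  if (i.2.2.1.Holds x ∧ ∀ d ∈ i.2.1, d.Holds x → d ≤ i.2.2.1) ∧ x i.1 = i.2.2.2 then 1 else 0

/-- For a single `x` the joint law is a point mass at the greatest satisfied link and `x v`. -/
theorem nodeSystem_linkValue {v : V} {D : Finset (PartialAssignment V)} (h0 : empty ∈ D)
    (hv : ∀ d ∈ D, d v = none) (hD : ∀ d ∈ D, ∀ d' ∈ D, d.dom ⊆ d'.dom ∨ d'.dom ⊆ d.dom)
    (x : V → Bool) : NodeSystem v D (fun t => t.ind x) (linkValue x) := by
  classical
  obtain ⟨m, hmD, hm⟩ := exists_greatest_holds h0 hD x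
  have hval : ∀ d ∈ D, ∀ a, linkValue x (v, D, d, a) =
      if m = d then (if x v = a then 1 else 0) else 0 := by
    intro d hd a
    have : (d.Holds x ∧ ∀ d' ∈ D, d'.Holds x → d' ≤ d) ↔ m = d := by
      constructor
      · rintro ⟨h1, h2⟩
        exact le_antisymm (h2 m hmD ((hm m hmD).2 le_rfl)) ((hm d hd).1 h1)
      · rintro rfl
        exact ⟨(hm m hd).2 le_rfl, fun d' hd' => (hm d' hd').1⟩
    simp only [linkValue, this, ite_and]
  refine ⟨fun d hd a => ?_, fun d hd => ?_, fun d hd a => ?_⟩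
  · rw [hval d hd]; split_ifs <;> norm_num
  · simp only [ind_set (hv d hd)]
    cases x v <;> simp
  · simp only [ind_set (hv d hd)]
    rw [Finset.sum_congr rfl fun d' hd' => hval d' (Finset.mem_filter.1 hd').1 a,
      Finset.sum_ite_eq]
    simp only [Finset.mem_filter, hmD, true_and, ind, hm d hd]
    split_ifs <;> simp

theorem listSystem_linkValue (x : V → Bool) (l : List V) :
    ∀ (P : Finset (PartialAssignment V)) (G : Hypergraph V), IsBetaLeafSeq G l →
      (∀ t ∈ P, t.dom.Nonempty → t.dom ∈ G.edgeSet) →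
      ListSystem (fun t => t.ind x) (linkValue x) l P := by
  induction l with
  | nil => intros; trivial
  | cons v l ih =>
    intro P G hseq hG
    refine ⟨nodeSystem_linkValue (empty_mem_links P v) (fun d => apply_eq_none_of_mem_links)
      (links_nested hseq.1 hG) x, ih _ (removeNode G v) hseq.2 ?_⟩
    intro t ht hne
    obtain ⟨t, htP, rfl⟩ := Finset.mem_image.1 ht
    rw [dom_erase] at hne ⊢
    exact ⟨hne, t.dom, hG t htP (hne.mono Set.sdiff_subset), rfl⟩

/-! ### Calculus of linear systems with coefficients `0, ±1`. -/

/-- `K` is the solution set of a system of at most `m` linear inequalities in the variables `W`,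
with coefficients and right-hand sides `0`, `1` and `-1`. An inequality is given by the set of the
variables with coefficient `1`, the set of those with coefficient `-1`, and the right-hand side. -/
def HasUnitSystem {X : Type*} (W : Finset X) (m : ℕ) (K : Set (X → ℝ)) : Prop :=
  ∃ L : Finset (Finset X × Finset X × SignType), L.card ≤ m ∧ (∀ q ∈ L, q.1 ⊆ W ∧ q.2.1 ⊆ W) ∧
    K = {y | ∀ q ∈ L, ∑ x ∈ q.1, y x - ∑ x ∈ q.2.1, y x ≤ ((q.2.2 : SignType) : ℝ)}

namespace HasUnitSystem

variable {X : Type*} {W W' : Finset X} {m m' : ℕ} {K K' : Set (X → ℝ)}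

theorem mono (h : HasUnitSystem W m K) (hW : W ⊆ W') (hm : m ≤ m') : HasUnitSystem W' m' K := by
  obtain ⟨L, hL, hLW, rfl⟩ := h
  exact ⟨L, hL.trans hm, fun q hq => ⟨(hLW q hq).1.trans hW, (hLW q hq).2.trans hW⟩, rfl⟩

theorem univ : HasUnitSystem W 0 (Set.univ : Set (X → ℝ)) :=
  ⟨∅, by simp, by simp, by simp⟩

theorem inter [DecidableEq X] (h : HasUnitSystem W m K) (h' : HasUnitSystem W' m' K') :
    HasUnitSystem (W ∪ W') (m + m') (K ∩ K') := by
  classical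
  obtain ⟨L, hL, hLW, rfl⟩ := h.mono (W' := W ∪ W') Finset.subset_union_left le_rfl
  obtain ⟨L', hL', hLW', rfl⟩ := h'.mono (W' := W ∪ W') Finset.subset_union_right le_rfl
  refine ⟨L ∪ L', (Finset.card_union_le _ _).trans (add_le_add hL hL'), fun q hq => ?_, ?_⟩
  · exact (Finset.mem_union.1 hq).elim (hLW q) (hLW' q)
  · ext y
    simp only [Set.mem_inter_iff, Set.mem_ofPred_eq, Finset.mem_union, or_imp, forall_and]

theorem biInter {α : Type*} {T : Finset α} {K : α → Set (X → ℝ)}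
    (h : ∀ i ∈ T, HasUnitSystem W m (K i)) :
    HasUnitSystem W (T.card * m) {y | ∀ i ∈ T, y ∈ K i} := by
  classical
  choose! L hL hLW hK using h
  refine ⟨T.biUnion L, Finset.card_biUnion_le_card_mul _ _ _ hL, fun q hq => ?_, ?_⟩
  · obtain ⟨i, hi, hq⟩ := Finset.mem_biUnion.1 hq
    exact hLW i hi q hq
  · ext y
    simp only [Set.mem_ofPred_eq, Finset.mem_biUnion]
    constructor
    · rintro hy q ⟨i, hi, hq⟩
      have := hy i hi
      rw [hK i hi] at this
      exact this q hq
    · intro hy i hi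
      rw [hK i hi]
      exact fun q hq => hy q ⟨i, hi, hq⟩

theorem nonneg {x : X} (hx : x ∈ W) : HasUnitSystem W 1 {y | 0 ≤ y x} := by
  refine ⟨{(∅, {x}, 0)}, by simp, by simpa using hx, ?_⟩
  ext y; simp

theorem sum_eq_sum {I J : Finset X} (hI : I ⊆ W) (hJ : J ⊆ W) :
    HasUnitSystem W 2 {y | ∑ x ∈ I, y x = ∑ x ∈ J, y x} := by
  classical
  refine ⟨{(I, J, 0), (J, I, 0)}, Finset.card_le_two, by simp [hI, hJ], ?_⟩
  ext y
  simp only [Set.mem_ofPred_eq, Finset.mem_insert, Finset.mem_singleton, forall_eq_or_imp,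
    forall_eq, SignType.coe_zero]
  exact ⟨fun h => ⟨by linarith, by linarith⟩, fun h => by linarith [h.1, h.2]⟩

theorem eq_one {x : X} (hx : x ∈ W) : HasUnitSystem W 2 {y | y x = 1} := by
  classical
  refine ⟨{({x}, ∅, 1), (∅, {x}, -1)}, Finset.card_le_two, by simp [hx], ?_⟩
  ext y
  simp only [Set.mem_ofPred_eq, Finset.mem_insert, Finset.mem_singleton, forall_eq_or_imp,
    forall_eq, Finset.sum_singleton, Finset.sum_empty, SignType.coe_one, SignType.coe_neg_one]
  exact ⟨fun h => ⟨by linarith, by linarith⟩, fun h => by linarith [h.1, h.2]⟩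

theorem convex (h : HasUnitSystem W m K) : Convex ℝ K := by
  obtain ⟨L, -, -, rfl⟩ := h
  intro y hy y' hy' a b ha hb hab q hq
  have h1 := mul_le_mul_of_nonneg_left (hy q hq) ha
  have h2 := mul_le_mul_of_nonneg_left (hy' q hq) hb
  simp only [Pi.add_apply, Pi.smul_apply, smul_eq_mul, Finset.sum_add_distrib, ← Finset.mul_sum]
  calc _ = a * (∑ x ∈ q.1, y x - ∑ x ∈ q.2.1, y x) + b * (∑ x ∈ q.1, y' x - ∑ x ∈ q.2.1, y' x) := by
        ring
    _ ≤ a * ((q.2.2 : SignType) : ℝ) + b * ((q.2.2 : SignType) : ℝ) := add_le_add h1 h2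
    _ = _ := by rw [← add_mul, hab, one_mul]

theorem convex_projection {ι Y : Type*} {W : Finset (ι ⊕ Y)} {K : Set (ι ⊕ Y → ℝ)}
    (h : HasUnitSystem W m K) : Convex ℝ {z | ∃ y, Sum.elim z y ∈ K} := by
  have : {z | ∃ y, Sum.elim z y ∈ K} = LinearMap.funLeft ℝ ℝ (Sum.inl : ι → ι ⊕ Y) '' K := by
    ext z
    constructor
    · rintro ⟨y, hy⟩
      exact ⟨_, hy, rfl⟩
    · rintro ⟨u, hu, rfl⟩
      exact ⟨u ∘ Sum.inr, by convert hu; ext (_ | _) <;> rfl⟩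
  rw [this]
  exact h.convex.linear_image _

/-- Only the variables in `W` occur, so the index type `Y` may be much larger than the formulation.
A coefficient is a difference of two indicators, hence `0` or `±1` even if the two sets overlap. -/
theorem hasUnitExtendedFormulation {ι Y : Type*} [Fintype ι] {W : Finset (ι ⊕ Y)} {m N : ℕ}
    {K : Set (ι ⊕ Y → ℝ)} (h : HasUnitSystem W m K) (hW : Fintype.card ι + W.card ≤ N)
    (hm : m ≤ N) : HasUnitExtendedFormulation {z | ∃ y, Sum.elim z y ∈ K} N := by
  classical
  obtain ⟨L, hL, hLW, rfl⟩ := h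
  let e := W.toRight.equivFin
  let q : Fin L.card → Finset (ι ⊕ Y) × Finset (ι ⊕ Y) × SignType := fun i => L.equivFin.symm i
  have hq : ∀ i, q i ∈ L := fun i => (L.equivFin.symm i).2
  let χ : Finset (ι ⊕ Y) → ι ⊕ Y → ℝ := fun I x => if x ∈ I then 1 else 0
  have hunit : ∀ I J x, χ I x - χ J x ∈ ({0, 1, -1} : Set ℝ) := by
    intro I J x
    simp only [χ]
    split_ifs <;> simp
  have hsum : ∀ I ⊆ W, ∀ (z : ι → ℝ) (y : Y → ℝ), ∑ x ∈ I, Sum.elim z y x =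
      ∑ j, χ I (Sum.inl j) * z j +
        ∑ l, χ I (Sum.inr (e.symm l : Y)) * y (e.symm l) := by
    intro I hI z y
    have h1 : ∑ l, χ I (Sum.inr (e.symm l : Y)) * y (e.symm l) = ∑ b ∈ I.toRight, y b := by
      rw [Equiv.sum_comp e.symm fun b : {b // b ∈ W.toRight} => χ I (Sum.inr (b : Y)) * y b,
        Finset.sum_coe_sort W.toRight fun b => χ I (Sum.inr b) * y b,
        ← Finset.sum_subset (Finset.toRight_subset_toRight hI)]
      · exact Finset.sum_congr rfl fun b hb => by simp [χ, Finset.mem_toRight.1 hb]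
      · intro b _ hb
        rw [Finset.mem_toRight] at hb
        simp [χ, hb]
    have h2 : ∑ j, χ I (Sum.inl j) * z j = ∑ j ∈ I.toLeft, z j := by
      rw [← Finset.sum_subset (Finset.subset_univ I.toLeft)]
      · exact Finset.sum_congr rfl fun b hb => by simp [χ, Finset.mem_toLeft.1 hb]
      · intro b _ hb
        rw [Finset.mem_toLeft] at hb
        simp [χ, hb]
    rw [h1, h2]
    rw [Finset.sum_sum_eq_sum_toLeft_add_sum_toRight]
    simp
  have hineq : ∀ i (z : ι → ℝ) (y : Y → ℝ),
      ∑ x ∈ (q i).1, Sum.elim z y x - ∑ x ∈ (q i).2.1, Sum.elim z y x =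
      ∑ j, (χ (q i).1 (Sum.inl j) - χ (q i).2.1 (Sum.inl j)) * z j +
      ∑ l, (χ (q i).1 (Sum.inr (e.symm l : Y)) - χ (q i).2.1 (Sum.inr (e.symm l : Y))) *
        y (e.symm l) := by
    intro i z y
    rw [hsum _ (hLW _ (hq i)).1, hsum _ (hLW _ (hq i)).2]
    simp only [sub_mul, Finset.sum_sub_distrib]
    ring
  refine ⟨L.card, W.toRight.card, fun i j => χ (q i).1 (Sum.inl j) - χ (q i).2.1 (Sum.inl j),
    fun i l => χ (q i).1 (Sum.inr (e.symm l : Y)) - χ (q i).2.1 (Sum.inr (e.symm l : Y)),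
    fun i => (((q i).2.2 : SignType) : ℝ), ?_, fun _ _ => hunit _ _ _, fun _ _ => hunit _ _ _,
    fun i => ?_, (Nat.add_le_add_left (Finset.card_toRight_le) _).trans hW, hL.trans hm⟩
  · ext z
    simp only [Set.mem_ofPred_eq]
    constructor
    · rintro ⟨y, hy⟩
      exact ⟨fun l => y (e.symm l), fun i => (hineq i z y).symm.trans_le (hy _ (hq i))⟩
    · rintro ⟨y, hy⟩
      -- Variables outside `W` occur in no inequality, so `0` is an arbitrary choice.
      refine ⟨fun b => if hb : b ∈ W.toRight then y (e ⟨b, hb⟩) else 0, fun r hr => ?_⟩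
      have hr' : q (L.equivFin ⟨r, hr⟩) = r := by simp [q]
      rw [← hr', hineq]
      convert hy (L.equivFin ⟨r, hr⟩) using 5
      simp
  · have hs : ∀ s : SignType, s = 0 ∨ s = 1 ∨ s = -1 := by decide
    rcases hs (q i).2.2 with h | h | h <;> simp [h]

end HasUnitSystem

/-! ### Size of the constraint systems. -/

section UnitSystem

variable {ι V : Type*}

/-- The variable that stands for the mass of a partial assignment. -/
abbrev massVar (ι : Type*) (t : PartialAssignment V) : ι ⊕ (PartialAssignment V ⊕ LinkIndex V) :=
  Sum.inr (Sum.inl t)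

/-- The variable with a given link index. -/
abbrev linkVar (ι : Type*) (i : LinkIndex V) : ι ⊕ (PartialAssignment V ⊕ LinkIndex V) :=
  Sum.inr (Sum.inr i)

theorem massVar_injective : Function.Injective (massVar ι : PartialAssignment V → _) :=
  Sum.inr_injective.comp Sum.inl_injective

theorem linkVar_injective : Function.Injective (linkVar ι : LinkIndex V → _) :=
  Sum.inr_injective.comp Sum.inr_injective

variable [DecidableEq V]

/-- Per link: one mass, two extended masses and two `w` variables make 5; two sign conditions and
three equations, counted twice, make 8. -/
theorem hasUnitSystem_nodeSystem (v : V) (D : Finset (PartialAssignment V)) :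
    ∃ W : Finset (ι ⊕ (PartialAssignment V ⊕ LinkIndex V)), W.card ≤ 5 * D.card ∧
      HasUnitSystem W (8 * D.card)
        {u | NodeSystem v D (fun t => u (massVar ι t)) fun i => u (linkVar ι i)} := by
  classical
  let DB : Finset (PartialAssignment V × Bool) := D ×ˢ Finset.univ
  have hDB : DB.card = D.card * 2 := by simp [DB]
  let W₁ := D.image (massVar ι)
  let W₂ := DB.image fun p => massVar ι (p.1.set v p.2)
  let W₃ := DB.image fun p => linkVar ι (v, D, p)
  have h₁ : ∀ d ∈ D, massVar ι d ∈ W₁ ∪ W₂ ∪ W₃ := fun d hd =>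
    Finset.mem_union_left _ (Finset.mem_union_left _ (Finset.mem_image_of_mem _ hd))
  have h₂ : ∀ d ∈ D, ∀ a, massVar ι (d.set v a) ∈ W₁ ∪ W₂ ∪ W₃ := fun d hd a =>
    Finset.mem_union_left _ (Finset.mem_union_right _
      (Finset.mem_image.2 ⟨(d, a), by simp [DB, hd], rfl⟩))
  have h₃ : ∀ d ∈ D, ∀ a, linkVar ι (v, D, d, a) ∈ W₁ ∪ W₂ ∪ W₃ := fun d hd a =>
    Finset.mem_union_right _ (Finset.mem_image.2 ⟨(d, a), by simp [DB, hd], rfl⟩)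
  refine ⟨W₁ ∪ W₂ ∪ W₃, ?_, ?_⟩
  · have hc₁ : W₁.card ≤ D.card := Finset.card_image_le
    have hc₂ : W₂.card ≤ DB.card := Finset.card_image_le
    have hc₃ : W₃.card ≤ DB.card := Finset.card_image_le
    have := Finset.card_union_le (W₁ ∪ W₂) W₃
    have := Finset.card_union_le W₁ W₂
    omega
  · have k₁ : HasUnitSystem (W₁ ∪ W₂ ∪ W₃) (DB.card * 1)
        {u | ∀ p ∈ DB, u ∈ {u | 0 ≤ u (linkVar ι (v, D, p))}} :=
      HasUnitSystem.biInter fun p hp =>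
        HasUnitSystem.nonneg (h₃ p.1 (Finset.mem_product.1 hp).1 p.2)
    have k₂ : HasUnitSystem (W₁ ∪ W₂ ∪ W₃) (D.card * 2)
        {u | ∀ d ∈ D, u ∈ {u | ∑ x ∈ {massVar ι d}, u x =
          ∑ x ∈ {massVar ι (d.set v true), massVar ι (d.set v false)}, u x}} :=
      HasUnitSystem.biInter fun d hd => HasUnitSystem.sum_eq_sum
        (Finset.singleton_subset_iff.2 (h₁ d hd))
        (Finset.insert_subset (h₂ d hd _) (Finset.singleton_subset_iff.2 (h₂ d hd _)))
    have k₃ : HasUnitSystem (W₁ ∪ W₂ ∪ W₃) (DB.card * 2)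
        {u | ∀ p ∈ DB, u ∈ {u | ∑ x ∈ {massVar ι (p.1.set v p.2)}, u x =
          ∑ x ∈ (D.filter (p.1 ≤ ·)).image fun d => linkVar ι (v, D, d, p.2), u x}} :=
      HasUnitSystem.biInter fun p hp => HasUnitSystem.sum_eq_sum
        (Finset.singleton_subset_iff.2 (h₂ p.1 (Finset.mem_product.1 hp).1 p.2))
        (Finset.image_subset_iff.2 fun d hd => h₃ d (Finset.mem_filter.1 hd).1 _)
    have := (k₁.inter k₂).inter k₃
    convert this.mono (m' := 8 * D.card) (W' := W₁ ∪ W₂ ∪ W₃) (by simp) (by omega) using 1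
    ext u
    have hpair : ∀ d : PartialAssignment V,
        massVar ι (d.set v true) ≠ massVar ι (d.set v false) := fun d h =>
      set_true_ne_set_false v d (massVar_injective h)
    have himage : ∀ (a : Bool) (T : Finset (PartialAssignment V)),
        ∑ x ∈ T.image fun d => linkVar ι (v, D, d, a), u x = ∑ d ∈ T, u (linkVar ι (v, D, d, a)) :=
      fun a T => Finset.sum_image fun d _ d' _ h => by
        have := linkVar_injective h
        simpa using this
    simp only [Set.mem_inter_iff, Set.mem_ofPred_eq, Finset.sum_singleton,
      Finset.sum_pair (hpair _), himage]
    constructor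
    · intro h
      exact ⟨⟨fun p hp => h.nonneg p.1 (Finset.mem_product.1 hp).1 p.2, h.split⟩,
        fun p hp => h.sum_eq p.1 (Finset.mem_product.1 hp).1 p.2⟩
    · rintro ⟨⟨h1, h2⟩, h3⟩
      exact ⟨fun d hd a => h1 (d, a) (by simp [DB, hd]), h2,
        fun d hd a => h3 (d, a) (by simp [DB, hd])⟩

/-- Erasing a node never enlarges the family, so `M` bounds it at every stage; `M + 1` allows for
the link `empty`. -/
theorem hasUnitSystem_listSystem (M : ℕ) (l : List V) :
    ∀ P : Finset (PartialAssignment V), P.card ≤ M →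
    ∃ W : Finset (ι ⊕ (PartialAssignment V ⊕ LinkIndex V)), W.card ≤ l.length * (5 * (M + 1)) ∧
      HasUnitSystem W (l.length * (8 * (M + 1)))
        {u | ListSystem (fun t => u (massVar ι t)) (fun i => u (linkVar ι i)) l P} := by
  classical
  induction l with
  | nil =>
    intro P _
    exact ⟨∅, by simp, HasUnitSystem.univ.mono (le_refl _) (by simp)⟩
  | cons v l ih =>
    intro P hP
    obtain ⟨W, hW, h⟩ := ih (P.image (erase v)) (Finset.card_image_le.trans hP)
    obtain ⟨W', hW', h'⟩ := hasUnitSystem_nodeSystem (ι := ι) v (links P v)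
    have hD : (links P v).card ≤ M + 1 := (card_links_le P v).trans (by omega)
    refine ⟨W' ∪ W, (Finset.card_union_le _ _).trans ?_, (h'.inter h).mono (le_refl _) ?_⟩
    · rw [List.length_cons, add_mul]; omega
    · rw [List.length_cons, add_mul]; omega

end UnitSystem

/-! ### Inflation of signed edges. -/

section Inflation

variable {V : Type*} [DecidableEq V]

/-- The partial assignment under which all factors of the product of a signed edge are `1`. -/
def SignedEdge.toPartialAssignment (s : SignedEdge V) : PartialAssignment V :=
  fun v => if h : v ∈ s.edge then some (decide (s.sign ⟨v, h⟩ = 1)) else none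

theorem SignedEdge.toPartialAssignment_apply {s : SignedEdge V} {v : V} (h : v ∈ s.edge) :
    s.toPartialAssignment v = some (decide (s.sign ⟨v, h⟩ = 1)) := dif_pos h

theorem SignedEdge.holds_toPartialAssignment {s : SignedEdge V} {x : V → Bool} :
    s.toPartialAssignment.Holds x ↔ ∀ v (h : v ∈ s.edge), x v = decide (s.sign ⟨v, h⟩ = 1) := by
  constructor
  · intro hx v h
    exact hx v _ (toPartialAssignment_apply h)
  · intro hx v a hv
    by_cases h : v ∈ s.edge
    · rw [toPartialAssignment_apply h] at hv
      rw [hx v h]; exact Option.some.inj hv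
    · rw [toPartialAssignment, dif_neg h] at hv; cases hv

theorem SignedEdge.prod_signedValue (s : SignedEdge V) (x : V → Bool) :
    ∏ v : {v // v ∈ s.edge}, signedValue (s.sign v) (if x v then 1 else 0) =
      s.toPartialAssignment.ind x := by
  have hval : ∀ v : {v // v ∈ s.edge}, signedValue (s.sign v) (if x v then 1 else 0) =
      if x v = decide (s.sign v = 1) then 1 else 0 := by
    intro v
    unfold signedValue
    by_cases h : s.sign v = 1 <;> cases x v <;> simp [h]
  simp only [hval, ind, holds_toPartialAssignment]
  split_ifs with h
  · exact Finset.prod_eq_one fun v _ => if_pos (h v.1 v.2)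
  · push Not at h
    obtain ⟨v, hv, hne⟩ := h
    exact Finset.prod_eq_zero (Finset.mem_univ ⟨v, hv⟩) (if_neg hne)

variable [Fintype V]

open Classical in
/-- The extensions of the partial assignment of a signed edge to the superset `F` of the edge. -/
noncomputable def SignedEdge.inflation (s : SignedEdge V) (F : Finset V) :
    Finset (PartialAssignment V) :=
  Finset.univ.filter fun t => s.toPartialAssignment ≤ t ∧ t.dom = F

theorem SignedEdge.mem_inflation {s : SignedEdge V} {F : Finset V} {t : PartialAssignment V} :
    t ∈ s.inflation F ↔ s.toPartialAssignment ≤ t ∧ t.dom = F := by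
  simp [inflation]

/-- An extension is determined by the set of nodes of `F \ s.edge` that it makes true. -/
theorem SignedEdge.card_inflation_le {s : SignedEdge V} {F : Finset V} (h : s.edge ⊆ F) :
    (s.inflation F).card ≤ 2 ^ (F.card - s.edge.card) := by
  classical
  rw [← Finset.card_sdiff_of_subset h, ← Finset.card_powerset]
  refine Finset.card_le_card_of_injOn (fun t => (F \ s.edge).filter fun v => t v = some true)
    (fun t _ => Finset.mem_powerset.2 (Finset.filter_subset _ _)) ?_
  intro t ht t' ht' heq
  obtain ⟨hle, hdom⟩ := mem_inflation.1 ht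
  obtain ⟨hle', hdom'⟩ := mem_inflation.1 ht'
  funext v
  by_cases hF : v ∈ F
  · by_cases hs : v ∈ s.edge
    · rw [hle v _ (toPartialAssignment_apply hs), hle' v _ (toPartialAssignment_apply hs)]
    · have h1 : v ∈ t.dom := by rw [hdom]; exact hF
      have h2 : v ∈ t'.dom := by rw [hdom']; exact hF
      obtain ⟨a, ha⟩ := Option.ne_none_iff_exists'.1 h1
      obtain ⟨b, hb⟩ := Option.ne_none_iff_exists'.1 h2
      have := Finset.ext_iff.1 heq v
      simp only [Finset.mem_filter, Finset.mem_sdiff, hF, hs, ha, hb] at this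
      rw [ha, hb]
      cases a <;> cases b <;> simp_all
  · have h1 : v ∉ t.dom := by rw [hdom]; exact hF
    have h2 : v ∉ t'.dom := by rw [hdom']; exact hF
    rw [mem_dom, not_not] at h1 h2
    rw [h1, h2]

/-- Exactly one assignment with domain `F` is satisfied by `x`, namely the restriction `t₀` of `x`;
it is a summand precisely when `x` satisfies `s`. -/
theorem SignedEdge.sum_ind_inflation {s : SignedEdge V} {F : Finset V} (h : s.edge ⊆ F)
    (x : V → Bool) : ∑ t ∈ s.inflation F, t.ind x = s.toPartialAssignment.ind x := by
  classical
  let t₀ : PartialAssignment V := fun v => if v ∈ F then some (x v) else none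
  have ht₀ : t₀.Holds x := by
    intro v a hv
    by_cases hF : v ∈ F
    · simpa [t₀, hF] using hv
    · simp [t₀, hF] at hv
  have hdom : t₀.dom = F := by
    ext v
    rw [mem_dom]
    by_cases hF : v ∈ F <;> simp [t₀, hF]
  have hind : ∀ t ∈ s.inflation F, t.ind x = if t = t₀ then 1 else 0 := by
    intro t ht
    have htd := (mem_inflation.1 ht).2
    have : t.Holds x ↔ t = t₀ := by
      constructor
      · intro hx
        exact le_antisymm (hx.le_of_dom_subset ht₀ (by rw [htd, hdom]))
          (ht₀.le_of_dom_subset hx (by rw [htd, hdom]))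
      · rintro rfl; exact ht₀
    simp only [ind, this]
  have hmem : t₀ ∈ s.inflation F ↔ s.toPartialAssignment.Holds x := by
    rw [mem_inflation, and_iff_left hdom]
    refine ⟨fun hle => ht₀.mono hle, fun hx => hx.le_of_dom_subset ht₀ ?_⟩
    rw [hdom]
    intro v hv
    by_contra hF
    exact hv (dif_neg fun hs => hF (h hs))
  rw [Finset.sum_congr rfl hind, Finset.sum_ite_eq']
  simp only [hmem, ind]

end Inflation

/-- Needed to conclude that a β-leaf sequence of full length lists every node. -/
theorem IsBetaLeafSeq.nodup {V : Type*} (l : List V) :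
    ∀ G : Hypergraph V, IsBetaLeafSeq G l → l.Nodup ∧ ∀ v ∈ l, v ∈ G.vertexSet := by
  induction l with
  | nil => intro G _; simp
  | cons v l ih =>
    intro G h
    obtain ⟨h1, h2⟩ := ih _ h.2
    refine ⟨List.nodup_cons.2 ⟨fun hv => (h2 v hv).2 rfl, h1⟩, fun u hu => ?_⟩
    rcases List.mem_cons.1 hu with rfl | hu
    · exact h.1.1
    · exact (h2 u hu).1

theorem HasUnitExtendedFormulation.mono {ι : Type*} [Fintype ι] {P : Set (ι → ℝ)} {N N' : ℕ}
    (h : HasUnitExtendedFormulation P N) (hN : N ≤ N') : HasUnitExtendedFormulation P N' := by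
  obtain ⟨m, p, A, B, b, h1, h2, h3, h4, h5, h6⟩ := h
  exact ⟨m, p, A, B, b, h1, h2, h3, h4, h5.trans hN, h6.trans hN⟩

theorem le_gap_pair {V : Type*} [DecidableEq V] (s f : SignedEdge V) :
    f.edge.card - s.edge.card ≤ SignedHypergraph.gap {s, f} := by
  have hs : s.edge ∈ ({s, f} : Finset (SignedEdge V)).image SignedEdge.edge :=
    Finset.mem_image_of_mem _ (Finset.mem_insert_self _ _)
  have hf : f.edge ∈ ({s, f} : Finset (SignedEdge V)).image SignedEdge.edge :=
    Finset.mem_image_of_mem _ (Finset.mem_insert_of_mem (Finset.mem_singleton_self _))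
  refine (Nat.sub_le_sub_right (Finset.card_le_card ?_) _).trans
    (Finset.le_sup (f := fun e => (Finset.biUnion _ id).card - e.card) hs)
  exact Finset.subset_biUnion_of_mem id hf

/-! ### Extended formulation of the pseudo-Boolean polytope. -/

namespace SignedHypergraph

theorem rank_le_card {V : Type*} [Fintype V] (H : SignedHypergraph V) :
    H.rank ≤ Fintype.card V :=
  Finset.sup_le fun s _ => s.edge.card_le_univ

variable {V : Type*} [DecidableEq V] (H : SignedHypergraph V)

/-- The point of the pseudo-Boolean set that is given by the values of the nodes. -/
noncomputable def pointOf (x : V → Bool) : H.Coord → ℝ :=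
  Sum.elim (fun v => if x v then 1 else 0) fun s => s.1.toPartialAssignment.ind x

theorem pseudoBooleanSet_eq_range : H.pseudoBooleanSet = Set.range H.pointOf := by
  ext z
  constructor
  · rintro ⟨hz, hprod⟩
    have hx : ∀ v, (if decide (z (Sum.inl v) = 1) then 1 else 0) = z (Sum.inl v) := by
      intro v
      rcases hz (Sum.inl v) with h | h <;> simp [h]
    refine ⟨fun v => decide (z (Sum.inl v) = 1), ?_⟩
    funext c
    rcases c with v | s
    · exact hx v
    · rw [hprod s, pointOf, Sum.elim_inr, ← SignedEdge.prod_signedValue]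
      simp only [hx]
  · rintro ⟨x, rfl⟩
    refine ⟨fun c => ?_, fun s => (SignedEdge.prod_signedValue s.1 x).symm⟩
    rcases c with v | s
    · simp only [pointOf, Sum.elim_inl]; split_ifs <;> simp
    · simp only [pointOf, Sum.elim_inr, ind]; split_ifs <;> simp

theorem ind_set_empty (v : V) (x : V → Bool) :
    (PartialAssignment.empty.set v true).ind x = if x v then 1 else 0 := by
  rw [ind_set rfl, ind_empty, Pi.one_apply, one_mul]

variable [Fintype V]

/-- A point whose coordinates are expectations lies in the pseudo-Boolean polytope. -/
theorem mem_pseudoBooleanPolytope {z : H.Coord → ℝ} (E : ((V → Bool) → ℝ) →ₗ[ℝ] ℝ)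
    (hE : ∀ g, 0 ≤ g → 0 ≤ E g) (hE1 : E 1 = 1) (hz : ∀ c, z c = E fun x => H.pointOf x c) :
    z ∈ H.pseudoBooleanPolytope := by
  classical
  -- The values of `E` at point indicators are the weights of a convex combination.
  have hsum : ∀ g, E g = ∑ x, g x * E fun y => if x = y then 1 else 0 := fun g =>
    LinearMap.pi_apply_eq_sum_univ E g
  have : z = ∑ x, (E fun y => if x = y then 1 else 0) • H.pointOf x := by
    funext c
    rw [hz, hsum, Finset.sum_apply]
    exact Finset.sum_congr rfl fun x _ => mul_comm _ _
  rw [this]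
  refine (convex_convexHull ℝ _).sum_mem (fun x _ => hE _ fun y => ?_) ?_ fun x _ =>
    subset_convexHull ℝ _ ?_
  · show (0 : ℝ) ≤ if x = y then 1 else 0
    split_ifs <;> norm_num
  · refine Eq.trans ?_ ((hsum 1).symm.trans hE1)
    exact Finset.sum_congr rfl fun x _ => (one_mul _).symm
  · rw [pseudoBooleanSet_eq_range]
    exact ⟨x, rfl⟩

/-- The constraints that describe the pseudo-Boolean polytope after each signed edge `s` has been
extended in all ways to the superset `F s`, and the nodes are removed in the order `l`. -/
structure InflatedSystem (F : SignedEdge V → Finset V) (l : List V)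
    (u : H.Coord ⊕ (PartialAssignment V ⊕ LinkIndex V) → ℝ) : Prop where
  mass_empty : u (massVar _ empty) = 1
  list : ListSystem (fun t => u (massVar _ t)) (fun i => u (linkVar _ i)) l
    (H.signedEdges.biUnion fun s => s.inflation (F s))
  node : ∀ v, u (Sum.inl (Sum.inl v)) = u (massVar _ (empty.set v true))
  edge : ∀ s : {s // s ∈ H.signedEdges},
    u (Sum.inl (Sum.inr s)) = ∑ t ∈ s.1.inflation (F s), u (massVar _ t)

theorem hasUnitSystem_inflatedSystem (F : SignedEdge V → Finset V) (l : List V) {M : ℕ}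
    (hM : (H.signedEdges.biUnion fun s => s.inflation (F s)).card ≤ M) :
    ∃ W : Finset (H.Coord ⊕ (PartialAssignment V ⊕ LinkIndex V)),
      W.card ≤ l.length * (5 * (M + 1)) + 1 + M + 2 * Fintype.card V + H.signedEdges.card ∧
      HasUnitSystem W
        (l.length * (8 * (M + 1)) + 2 + 2 * Fintype.card V + 2 * H.signedEdges.card)
        {u | H.InflatedSystem F l u} := by
  classical
  set P := H.signedEdges.biUnion fun s => s.inflation (F s) with hP
  obtain ⟨W₀, hW₀, h₀⟩ := hasUnitSystem_listSystem (ι := H.Coord) M l P hM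
  let W₁ : Finset (H.Coord ⊕ (PartialAssignment V ⊕ LinkIndex V)) := {massVar _ empty}
  let W₂ := P.image (massVar H.Coord)
  let W₃ := (Finset.univ : Finset H.Coord).image
    (Sum.inl : _ → H.Coord ⊕ (PartialAssignment V ⊕ LinkIndex V))
  let W₄ := (Finset.univ : Finset V).image fun v => massVar H.Coord (empty.set v true)
  let W := W₀ ∪ W₁ ∪ W₂ ∪ W₃ ∪ W₄
  have c₁ : W₁.card = 1 := Finset.card_singleton _
  have c₂ : W₂.card ≤ P.card := Finset.card_image_le
  have c₃ : W₃.card ≤ Fintype.card V + H.signedEdges.card :=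
    Finset.card_image_le.trans (by simp [Coord])
  have c₄ : W₄.card ≤ Fintype.card V := Finset.card_image_le
  have s₀ : W₀ ⊆ W := fun x hx => by simp only [W, Finset.mem_union, hx, true_or]
  have s₁ : massVar H.Coord empty ∈ W := by
    have : massVar H.Coord empty ∈ W₁ := Finset.mem_singleton_self _
    simp only [W, Finset.mem_union, this, true_or, or_true]
  have s₂ : ∀ t ∈ P, massVar H.Coord t ∈ W := fun t ht => by
    have : massVar H.Coord t ∈ W₂ := Finset.mem_image_of_mem _ ht
    simp only [W, Finset.mem_union, this, true_or, or_true]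
  have s₃ : ∀ c : H.Coord, Sum.inl c ∈ W := fun c => by
    have : Sum.inl c ∈ W₃ := Finset.mem_image_of_mem _ (Finset.mem_univ c)
    simp only [W, Finset.mem_union, this, true_or, or_true]
  have s₄ : ∀ v, massVar H.Coord (empty.set v true) ∈ W := fun v => by
    have : massVar H.Coord (empty.set v true) ∈ W₄ :=
      Finset.mem_image.2 ⟨v, Finset.mem_univ v, rfl⟩
    simp only [W, Finset.mem_union, this, or_true]
  refine ⟨W, ?_, ?_⟩
  · have : W.card ≤ _ := Finset.card_union_le (W₀ ∪ W₁ ∪ W₂ ∪ W₃) W₄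
    have := Finset.card_union_le (W₀ ∪ W₁ ∪ W₂) W₃
    have := Finset.card_union_le (W₀ ∪ W₁) W₂
    have := Finset.card_union_le W₀ W₁
    omega
  · clear_value W
    have k₀ := h₀.mono s₀ le_rfl
    have k₁ : HasUnitSystem W 2 {u | u (massVar _ empty) = 1} :=
      HasUnitSystem.eq_one s₁
    have k₂ : HasUnitSystem W ((Finset.univ : Finset V).card * 2)
        {u | ∀ v ∈ Finset.univ, u ∈ {u | ∑ x ∈ {Sum.inl (Sum.inl v)}, u x =
          ∑ x ∈ {massVar H.Coord (empty.set v true)}, u x}} :=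
      HasUnitSystem.biInter fun v _ => HasUnitSystem.sum_eq_sum
        (Finset.singleton_subset_iff.2 (s₃ _))
        (Finset.singleton_subset_iff.2 (s₄ v))
    have k₃ : HasUnitSystem W ((Finset.univ : Finset {s // s ∈ H.signedEdges}).card * 2)
        {u | ∀ s ∈ Finset.univ, u ∈ {u | ∑ x ∈ {Sum.inl (Sum.inr s)}, u x =
          ∑ x ∈ (s.1.inflation (F s)).image (massVar H.Coord), u x}} :=
      HasUnitSystem.biInter fun s _ => HasUnitSystem.sum_eq_sum
        (Finset.singleton_subset_iff.2 (s₃ _))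
        (Finset.image_subset_iff.2 fun t ht => s₂ t (Finset.mem_biUnion.2 ⟨s, s.2, ht⟩))
    have := ((k₀.inter k₁).inter k₂).inter k₃
    convert this.mono (W' := W) (by simp) (le_of_eq ?_) using 1
    · ext u
      have himage : ∀ T : Finset (PartialAssignment V),
          ∑ x ∈ T.image (massVar H.Coord), u x = ∑ t ∈ T, u (massVar H.Coord t) := fun T =>
        Finset.sum_image fun t _ t' _ h => massVar_injective h
      simp only [Set.mem_inter_iff, Set.mem_ofPred_eq, Finset.sum_singleton, himage,
        Finset.mem_univ, true_implies]
      exact ⟨fun h => ⟨⟨⟨h.list, h.mass_empty⟩, h.node⟩, h.edge⟩,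
        fun h => ⟨h.1.1.2, h.1.1.1, h.1.2, h.2⟩⟩
    · rw [Finset.card_univ, Finset.card_univ, Fintype.card_coe]
      ring

/-- If the supersets `F s` are edges of a β-acyclic hypergraph, then the constraints describe the
pseudo-Boolean polytope. -/
theorem pseudoBooleanPolytope_eq_projection {F : SignedEdge V → Finset V} {l : List V}
    {G : Hypergraph V} (hseq : IsBetaLeafSeq G l) (hl : ∀ v, v ∈ l)
    (hF : ∀ s ∈ H.signedEdges, s.edge ⊆ F s) (hG : ∀ s ∈ H.signedEdges, (F s : Set V) ∈ G.edgeSet) :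
    H.pseudoBooleanPolytope = {z | ∃ y, Sum.elim z y ∈ {u | H.InflatedSystem F l u}} := by
  have hdom : ∀ t ∈ H.signedEdges.biUnion fun s => s.inflation (F s),
      t.dom.Nonempty → t.dom ∈ G.edgeSet := by
    intro t ht _
    obtain ⟨s, hs, ht⟩ := Finset.mem_biUnion.1 ht
    rw [(SignedEdge.mem_inflation.1 ht).2]
    exact hG s hs
  apply Set.Subset.antisymm
  · obtain ⟨W, -, hW⟩ := H.hasUnitSystem_inflatedSystem F l le_rfl
    -- The projection is convex, so it suffices to lift the `0/1` points.
    refine convexHull_min ?_ hW.convex_projection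
    rw [pseudoBooleanSet_eq_range]
    rintro _ ⟨x, rfl⟩
    refine ⟨Sum.elim (fun t => t.ind x) (linkValue x), ?_, listSystem_linkValue x l _ G hseq hdom,
      fun v => (ind_set_empty v x).symm, fun s => (SignedEdge.sum_ind_inflation (hF s s.2) x).symm⟩
    exact congrFun ind_empty x
  · rintro z ⟨y, hu⟩
    obtain ⟨E, hE, hE1, hEP, hEl⟩ := hu.list.exists_expectation hu.mass_empty l _ G hseq hdom
      fun _ _ v _ => hl v
    refine H.mem_pseudoBooleanPolytope E hE hE1 fun c => ?_
    rcases c with v | s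
    · refine (hu.node v).trans ((hEl v (hl v)).trans (congrArg E ?_))
      exact funext fun x => ind_set_empty v x
    · refine (hu.edge s).trans ?_
      rw [Finset.sum_congr rfl fun t ht => hEP t (Finset.mem_biUnion.2 ⟨s, s.2, ht⟩), ← map_sum]
      refine congrArg E (funext fun x => ?_)
      rw [Finset.sum_apply]
      exact SignedEdge.sum_ind_inflation (hF s s.2) x

/-- The bound on the size of the extended formulation. -/
theorem hasUnitExtendedFormulation_pseudoBooleanPolytope {k : ℕ} {f : SignedEdge V → SignedEdge V}
    (hne : H.signedEdges.Nonempty) (hf : ∀ s ∈ H.signedEdges, H.IsMinMaximalContaining s (f s))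
    (hk : ∀ s ∈ H.signedEdges, gap {s, f s} ≤ k) (hβ : BetaAcyclic H.maximalPart.underlying) :
    HasUnitExtendedFormulation H.pseudoBooleanPolytope
      (22 * (H.rank * 2 ^ k * Fintype.card V * H.signedEdges.card)) := by
  obtain ⟨l, hseq, hlen⟩ := hβ
  have hlen' : l.length = Fintype.card V := by
    rw [hlen]
    exact (Set.ncard_univ V).trans Nat.card_eq_fintype_card
  have hl : ∀ v, v ∈ l := by
    have h1 := (IsBetaLeafSeq.nodup l _ hseq).1
    intro v
    have : l.toFinset = Finset.univ :=
      Finset.eq_univ_of_card _ ((List.toFinset_card_of_nodup h1).trans hlen')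
    rw [← List.mem_toFinset, this]
    exact Finset.mem_univ v
  have hF : ∀ s ∈ H.signedEdges, s.edge ⊆ (f s).edge := fun s hs => (hf s hs).1.2
  rw [H.pseudoBooleanPolytope_eq_projection hseq hl hF fun s hs =>
    ⟨f s, by classical exact Finset.mem_filter.2 ⟨(hf s hs).1.1.1, (hf s hs).1.1⟩, rfl⟩]
  have hM : (H.signedEdges.biUnion fun s => s.inflation (f s).edge).card ≤
      H.signedEdges.card * 2 ^ k :=
    Finset.card_biUnion_le_card_mul _ _ _ fun s hs => (SignedEdge.card_inflation_le (hF s hs)).trans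
      (Nat.pow_le_pow_right two_pos ((le_gap_pair s (f s)).trans (hk s hs)))
  obtain ⟨W, hW, h⟩ := H.hasUnitSystem_inflatedSystem (fun s => (f s).edge) l hM
  obtain ⟨s, hs⟩ := hne
  have hr : 1 ≤ H.rank := le_trans (by have := s.two_le_card; omega)
    (Finset.le_sup (f := fun s : SignedEdge V => s.edge.card) hs)
  have hn : 1 ≤ Fintype.card V := hr.trans H.rank_le_card
  have hS : 1 ≤ H.signedEdges.card := Finset.card_pos.2 ⟨s, hs⟩
  have hp : 1 ≤ 2 ^ k := Nat.one_le_two_pow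
  have hcard : Fintype.card H.Coord = Fintype.card V + H.signedEdges.card := by simp [Coord]
  rw [hlen'] at hW h
  generalize H.rank = r at *
  generalize Fintype.card V = n at *
  generalize H.signedEdges.card = S at *
  generalize 2 ^ k = p at *
  -- All terms are compared with `n * (S * p)`; the factor `r` enters only through `1 ≤ r`. The
  -- inequalities need 8 + 8 + 2 + 2 + 2 = 22 copies, the variables only 17.
  have e₀ : n * (S * p) ≤ r * p * n * S := by
    calc n * (S * p) = 1 * (p * n * S) := by ring
      _ ≤ r * (p * n * S) := Nat.mul_le_mul_right _ hr
      _ = _ := by ring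
  have e₁ : S * p ≤ n * (S * p) := Nat.le_mul_of_pos_left _ hn
  have e₂ : S ≤ S * p := Nat.le_mul_of_pos_right _ hp
  have e₃ : n ≤ n * (S * p) := Nat.le_mul_of_pos_right _ (Nat.mul_pos hS hp)
  have e₄ : n * (5 * (S * p + 1)) = 5 * (n * (S * p)) + 5 * n := by ring
  have e₅ : n * (8 * (S * p + 1)) = 8 * (n * (S * p)) + 8 * n := by ring
  exact h.hasUnitExtendedFormulation (by omega) (by omega)

end SignedHypergraph

/-- Compare logarithms, using `log 2 ≤ 1`. The summand 1 covers `p = 0`, where `k = 0` but the power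
of `p` may vanish. -/
theorem two_pow_le_of_le_mul_log {k p : ℕ} {c : ℝ} (h : (k : ℝ) ≤ c * Real.log (p : ℕ)) :
    2 ^ k ≤ p ^ ⌈c⌉₊ + 1 := by
  rcases Nat.eq_zero_or_pos p with rfl | hp
  · have : k = 0 := by simpa using h
    simp [this]
  have hlog : 0 ≤ Real.log p := Real.log_natCast_nonneg p
  have h1 : (k : ℝ) * Real.log 2 ≤ ⌈c⌉₊ * Real.log p :=
    calc (k : ℝ) * Real.log 2 ≤ k * 1 := by
          gcongr
          linarith [Real.log_two_lt_d9]
      _ ≤ c * Real.log p := by rwa [mul_one]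
      _ ≤ ⌈c⌉₊ * Real.log p := mul_le_mul_of_nonneg_right (Nat.le_ceil c) hlog
  have h2 : (2 : ℝ) ^ k ≤ (p : ℝ) ^ ⌈c⌉₊ := by
    rw [← Real.log_pow, ← Real.log_pow] at h1
    exact (Real.log_le_log_iff (by positivity) (by positivity)).1 h1
  exact (by exact_mod_cast h2 : 2 ^ k ≤ p ^ ⌈c⌉₊).trans (Nat.le_succ _)

end PseudoBoolean

theorem mainTheorem8 :
    (∃ C : ℕ, ∀ (V : Type u) [Fintype V] [DecidableEq V]
      (H : PseudoBoolean.SignedHypergraph V) (k : ℕ)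
      (f : PseudoBoolean.SignedEdge V → PseudoBoolean.SignedEdge V),
      H.signedEdges.Nonempty →
      (∀ s ∈ H.signedEdges, H.IsMinMaximalContaining s (f s)) →
      (∀ s ∈ H.signedEdges, PseudoBoolean.SignedHypergraph.gap {s, f s} ≤ k) →
      PseudoBoolean.BetaAcyclic H.maximalPart.underlying →
      PseudoBoolean.HasUnitExtendedFormulation H.pseudoBooleanPolytope
        (C * (H.rank * 2 ^ k * Fintype.card V * H.signedEdges.card))) ∧
    (∀ (c : ℝ) (P : MvPolynomial (Fin 2) ℕ), ∃ Q : MvPolynomial (Fin 2) ℕ,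
      ∀ (V : Type u) [Fintype V] [DecidableEq V]
      (H : PseudoBoolean.SignedHypergraph V) (k : ℕ)
      (f : PseudoBoolean.SignedEdge V → PseudoBoolean.SignedEdge V),
      H.signedEdges.Nonempty →
      (∀ s ∈ H.signedEdges, H.IsMinMaximalContaining s (f s)) →
      (∀ s ∈ H.signedEdges, PseudoBoolean.SignedHypergraph.gap {s, f s} ≤ k) →
      PseudoBoolean.BetaAcyclic H.maximalPart.underlying →
      (k : ℝ) ≤ c * Real.log
        (MvPolynomial.eval ![Fintype.card V, H.signedEdges.card] P : ℕ) →
      PseudoBoolean.HasUnitExtendedFormulation H.pseudoBooleanPolytope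
        (MvPolynomial.eval ![Fintype.card V, H.signedEdges.card] Q)) := by
  refine ⟨⟨22, fun V _ _ H k f hne hf hk hβ =>
    H.hasUnitExtendedFormulation_pseudoBooleanPolytope hne hf hk hβ⟩, fun c P => ?_⟩
  -- The first `X 0` replaces the rank, which is at most `|V|`, and `P ^ ⌈c⌉₊ + 1` replaces `2 ^ k`.
  refine ⟨22 * (MvPolynomial.X 0 * (P ^ ⌈c⌉₊ + 1) * MvPolynomial.X 0 * MvPolynomial.X 1),
    fun V _ _ H k f hne hf hk hβ hc => ?_⟩
  refine (H.hasUnitExtendedFormulation_pseudoBooleanPolytope hne hf hk hβ).mono ?_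
  simp only [map_mul, map_add, map_pow, map_one, map_ofNat, MvPolynomial.eval_X,
    Matrix.cons_val_zero, Matrix.cons_val_one]
  gcongr
  · exact H.rank_le_card
  · exact PseudoBoolean.two_pow_le_of_le_mul_log hc
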